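/- Consider finite (possibly empty) sequences $(\lambda_1,\dots,\lambda_s)$ of non-negative integers, each having one of the three colors $a,b,u$, where for each positive colored integer its final occurrence in the sequence may be overlined (no other parts may be overlined). Call such a sequence a jagged overpartition if $\lambda_s\notin\{0_a,0_b,\overline{1}_a,\overline{1}_b\}$ and, for every $1\le m<s$, the difference $\lambda_m-\lambda_{m+1}$ is at least the entry in the row of $\lambda_m$ and the column of $\lambda_{m+1}$ of the matrix $$ \overline{C}=\begin{array}{c|cccccc} & \overline{a} & \overline{b} & \overline{u} & a & b & u\\ \hline \overline{a} & 2 & 0 & 2 & 2 & 0 & 2\\ \overline{b} & 2 & 2 & 3 & 2 & 2 & 3\\ \overline{u} & 1 & 0 & 1 & 1 & 0 & 1\\ a & 1 & -1 & 1 & 1 & -1 & 1\\ b & 1 & 1 & 2 & 1 & 1 & 2\\ u & 0 & -1 & 0 & 0 & -1 & 0 \end{array} $$ (rows and columns $\overline{a},\overline{b},\overline{u}$ refer to overlined parts of that color, and $a,b,u$ to non-overlined ones). Let $\overline{C}_2(n;k;i,j)$ be the number of jagged overpartitions whose parts sum to $n$, with exactly $k$ non-overlined parts, $i$ parts colored $a$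 and $j$ parts colored $b$, and such that the final $\ell$ parts are overlined, where $\ell$ is the number of parts of color $b$ or $u$. Write $(x;Q)_\infty=\prod_{m\ge 0}(1-xQ^m)$ and $(x)_\infty=(x;q)_\infty$. Then, as formal power series in $a,b,q$, $$ \sum_{n,k,i,j\ge 0}\overline{C}_2(n;k;i,j)\,a^ib^jq^n=(-q)_\infty\,(-aq)_\infty\,(-bq^2;q^2)_\infty . $$ -/

import Mathlib

open scoped MvPowerSeries.WithPiTopology

namespace Capparelli

/-- The three colors of parts. -/
inductive Color : Type
  | a
  | b
  | u
  deriving DecidableEq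

/-- A colored part: a non-negative integer with a color, which may or may not be overlined. -/
structure Part : Type where
  size : ℕ
  color : Color
  overlined : Bool
  deriving DecidableEq

/-- The entry in row `x` (a color, overlined iff the flag is `true`) and column `y` of the matrix
of minimal differences. The columns of overlined and non-overlined `y` coincide. -/
def minDiff : Bool → Color → Color → ℤ
  | true, .a, .a => 2
  | true, .a, .b => 0
  | true, .a, .u => 2
  | true, .b, .a => 2
  | true, .b, .b => 2
  | true, .b, .u => 3
  | true, .u, .a => 1
  | true, .u, .b => 0
  | true, .u, .u => 1
  | false, .a, .a => 1
  | false, .a, .b => -1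
  | false, .a, .u => 1
  | false, .b, .a => 1
  | false, .b, .b => 1
  | false, .b, .u => 2
  | false, .u, .a => 0
  | false, .u, .b => -1
  | false, .u, .u => 0

/-- The jagged overpartitions: finite sequences (possibly empty) of colored parts, where
* only positive parts may be overlined;
* only the final occurrence of a given colored integer may be overlined;
* the last part is none of `0_a`, `0_b`, overlined `1_a`, overlined `1_b`;
* the difference of successive parts is at least the corresponding entry of the matrix. -/
structure IsJagged (l : List Part) : Prop where
  pos_of_overlined : ∀ x ∈ l, x.overlined = true → 0 < x.size
  final_of_overlined :
    l.Pairwise fun x y => x.overlined = true → ¬ (y.size = x.size ∧ y.color = x.color)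
  last_notMem : ∀ x ∈ l.getLast?,
    x ∉ [(⟨0, .a, false⟩ : Part), ⟨0, .b, false⟩, ⟨1, .a, true⟩, ⟨1, .b, true⟩]
  diff_le : l.IsChain fun x y =>
    minDiff x.overlined x.color y.color ≤ (x.size : ℤ) - (y.size : ℤ)

/-- The number of parts of color `c`. -/
def numColor (c : Color) (l : List Part) : ℕ := l.countP fun x => x.color = c

/-- The number of non-overlined parts. -/
def numNonOverlined (l : List Part) : ℕ := l.countP fun x => !x.overlined

/-- The jagged overpartitions of `n` with `k` non-overlined parts, `i` parts colored `a` and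
`j` parts colored `b`. -/
def jagged (n k i j : ℕ) : Set (List Part) :=
  {l | IsJagged l ∧ (l.map Part.size).sum = n ∧ numNonOverlined l = k ∧
    numColor .a l = i ∧ numColor .b l = j}

/-- Those members of `jagged n k i j` whose final `ℓ` parts are overlined, where `ℓ` is the number
of parts of color `b` or `u`. -/
def jagged₂ (n k i j : ℕ) : Set (List Part) :=
  {l | l ∈ jagged n k i j ∧
    ∀ x ∈ l.drop (l.length - (numColor .b l + numColor .u l)), x.overlined = true}

/-- The number of elements of the (finite) set `jagged₂ n k i j`. -/
noncomputable def C₂ (n k i j : ℕ) : ℕ := (jagged₂ n k i j).ncard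

lemma length_le (l : List Part) (h : IsJagged l) :
    l.length ≤ (l.map Part.size).sum + numNonOverlined l := by
  have h' := h.pos_of_overlined
  clear h
  induction l with
  | nil => simp
  | cons x l ih =>
    have h1 := ih fun y hy => h' y (List.mem_cons_of_mem _ hy)
    have h2 := h' x List.mem_cons_self
    unfold numNonOverlined at *
    simp only [List.length_cons, List.map_cons, List.sum_cons, List.countP_cons]
    cases hx : x.overlined
    · simp; omega
    · have := h2 hx
      simp; omega

lemma finite_jagged (n k i j : ℕ) : (jagged n k i j).Finite := by
  let f : Fin (n + 1) × Fin 3 × Bool → Part := fun p =>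
    ⟨p.1, match p.2.1 with | 0 => .a | 1 => .b | 2 => .u, p.2.2⟩
  refine ((List.finite_length_le (Fin (n + 1) × Fin 3 × Bool) (n + k)).image
    (List.map f)).subset ?_
  rintro l ⟨hl, hn, hk, -, -⟩
  have hlen := length_le l hl
  have hf : ∀ x ∈ l, x ∈ Set.range f := by
    intro x hx
    have hx' : x.size ≤ n := hn ▸ List.le_sum_of_mem (List.mem_map_of_mem hx)
    obtain ⟨s, c, o⟩ := x
    refine ⟨(⟨s, Nat.lt_succ_of_le hx'⟩, match c with | .a => 0 | .b => 1 | .u => 2, o), ?_⟩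
    cases c <;> rfl
  obtain ⟨m, rfl⟩ : l ∈ Set.range (List.map f) := by
    rw [Set.range_list_map]; exact hf
  refine ⟨m, ?_, rfl⟩
  simp only [List.length_map] at hlen
  simp only [Set.mem_ofPred_eq]
  omega

lemma finite_jagged₂ (n k i j : ℕ) : (jagged₂ n k i j).Finite :=
  (finite_jagged n k i j).subset fun _ h => h.1

/-- The ring `ℤ⟦a, b, q⟧` of formal power series, with the topology of coefficientwise
convergence. -/
abbrev Ser : Type := MvPowerSeries (Fin 3) ℤ

noncomputable def a : Ser := MvPowerSeries.X 0
noncomputable def b : Ser := MvPowerSeries.X 1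
noncomputable def q : Ser := MvPowerSeries.X 2

/-- The infinite `q`-Pochhammer symbol `(x; Q)_∞ = ∏_{m ≥ 0} (1 - x Q ^ m)`. -/
noncomputable def qPoch (x Q : Ser) : Ser := ∏' m : ℕ, (1 - x * Q ^ m)

/-- The product defining `qPoch x Q` converges whenever `Q` has no constant term. -/
lemma multipliable_qPoch (x Q : Ser) (hQ : MvPowerSeries.constantCoeff Q = 0) :
    Multipliable fun m : ℕ => 1 - x * Q ^ m := by
  simp only [sub_eq_add_neg]
  apply MvPowerSeries.WithPiTopology.multipliable_one_add_of_tendsto_order_atTop_nhds_top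
  refine tendsto_nhds_top_mono (f := fun m : ℕ => (m : ℕ∞)) ?_ ?_
  · rw [ENat.tendsto_nhds_top_iff_natCast_lt]
    intro m
    filter_upwards [Filter.eventually_gt_atTop m] with t ht
    exact_mod_cast ht
  · refine Filter.Eventually.of_forall fun m => ?_
    beta_reduce
    rw [MvPowerSeries.order_neg]
    calc (m : ℕ∞) ≤ (Q ^ m).order := MvPowerSeries.le_order_pow_of_constantCoeff_eq_zero m hQ
      _ ≤ x.order + (Q ^ m).order := le_add_self
      _ ≤ (x * Q ^ m).order := MvPowerSeries.le_order_mul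

end Capparelli

open scoped MvPowerSeries.WithPiTopology

namespace Capparelli

/-! Lower every part colored `b` by one. The matrix entry then becomes `cost`, which depends only on
the two colors, plus 1 if the upper part is overlined (`minDiff_eq`). The conditions on the last
part amount to placing a virtual part of color `a` and lowered size 0 after the sequence
(`isJagged_reverse_iff`). A jagged overpartition is thus freely encoded by colors, overlining flags
and excesses of differences.

Fix the numbers of letters of each color. Removing the last part, whose step is added to all `s`
parts, gives a recursion with a factor `1 / (1 - q ^ s)`. The overlining of the `p`-th part
contributes a factor independent of the colors, so the generating function is a product of these
factors and a series over color words (`hasSum_term`). The closed form `wordSeries` satisfies the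
recursion for the words (`wordSeries_rec`).

With `i`, `j`, `m` letters `a`, `b`, `u`, all parts after the first `i` must be overlined. The
exponents then combine so that the term factors into Euler summands (`countsTerm_eq`). The sum over
`m` gives `(-q)_∞` whatever `i` and `j` are, and Euler's identity (`hasSum_eulerTerm`) evaluates the
sums over `j` and `i`. -/

/-- The finite `q`-Pochhammer symbol `(Q; Q)_n`. -/
noncomputable def poch (Q : Ser) (n : ℕ) : Ser := ∏ k ∈ Finset.range n, (1 - Q ^ (k + 1))

/-- The finite `q`-Pochhammer symbol `(-q; q)_n`. -/
noncomputable def negPoch (n : ℕ) : Ser := ∏ k ∈ Finset.range n, (1 + q ^ (k + 1))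

/-- The inverse of `(Q; Q)_n`. -/
noncomputable def pochInv (Q : Ser) (n : ℕ) : Ser := Ring.inverse (poch Q n)

lemma isUnit_poch {Q : Ser} (hQ : MvPowerSeries.constantCoeff Q = 0) (n : ℕ) :
    IsUnit (poch Q n) := by
  rw [MvPowerSeries.isUnit_iff_constantCoeff, poch, map_prod]
  simp [hQ]

lemma poch_mul_pochInv {Q : Ser} (hQ : MvPowerSeries.constantCoeff Q = 0) (n : ℕ) :
    poch Q n * pochInv Q n = 1 :=
  Ring.mul_inverse_cancel _ (isUnit_poch hQ n)

lemma pochInv_zero (Q : Ser) : pochInv Q 0 = 1 := by simp [pochInv, poch]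

lemma poch_succ (Q : Ser) (n : ℕ) : poch Q (n + 1) = poch Q n * (1 - Q ^ (n + 1)) :=
  Finset.prod_range_succ _ _

lemma negPoch_succ (n : ℕ) : negPoch (n + 1) = negPoch n * (1 + q ^ (n + 1)) :=
  Finset.prod_range_succ _ _

lemma pochInv_eq_succ {Q : Ser} (hQ : MvPowerSeries.constantCoeff Q = 0) (n : ℕ) :
    pochInv Q n = (1 - Q ^ (n + 1)) * pochInv Q (n + 1) := by
  apply (isUnit_poch hQ n).mul_left_cancel
  rw [poch_mul_pochInv hQ, ← mul_assoc, ← poch_succ, poch_mul_pochInv hQ]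

lemma constantCoeff_q : MvPowerSeries.constantCoeff q = 0 := MvPowerSeries.constantCoeff_X 2

lemma constantCoeff_q_sq : MvPowerSeries.constantCoeff (q ^ 2) = 0 := by simp [constantCoeff_q]

lemma summable_of_le_order {f : ℕ → Ser} (h : ∀ n : ℕ, (n : ℕ∞) ≤ (f n).order) : Summable f := by
  apply MvPowerSeries.WithPiTopology.summable_of_tendsto_order_atTop_nhds_top
  refine tendsto_nhds_top_mono (f := fun m : ℕ => (m : ℕ∞)) ?_ (Filter.Eventually.of_forall h)
  rw [ENat.tendsto_nhds_top_iff_natCast_lt]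
  intro m
  filter_upwards [Filter.eventually_gt_atTop m] with t ht
  exact_mod_cast ht

lemma le_order_of_pow_dvd {Q : Ser} (hQ : MvPowerSeries.constantCoeff Q = 0) {n : ℕ} {f : Ser}
    (h : Q ^ n ∣ f) : (n : ℕ∞) ≤ f.order := by
  obtain ⟨g, rfl⟩ := h
  calc (n : ℕ∞) ≤ (Q ^ n).order := MvPowerSeries.le_order_pow_of_constantCoeff_eq_zero n hQ
    _ ≤ (Q ^ n).order + g.order := le_self_add
    _ ≤ _ := MvPowerSeries.le_order_mul

lemma tendsto_zero_of_le_order {f : ℕ → Ser} (h : ∀ n : ℕ, (n : ℕ∞) ≤ (f n).order) :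
    Filter.Tendsto f Filter.atTop (nhds 0) := (summable_of_le_order h).tendsto_atTop_zero

/-! ### Euler's expansion of the infinite Pochhammer symbol -/

/-- The summand of Euler's expansion of `(-x; Q)_∞`. -/
noncomputable def eulerTerm (Q x : Ser) (m : ℕ) : Ser := x ^ m * Q ^ (m.choose 2) * pochInv Q m

lemma summable_eulerTerm {Q : Ser} (hQ : MvPowerSeries.constantCoeff Q = 0) (x : Ser) :
    Summable (eulerTerm Q x) := by
  rw [← summable_nat_add_iff 1, ← summable_nat_add_iff 1]
  refine summable_of_le_order fun n => le_order_of_pow_dvd hQ ?_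
  refine Dvd.dvd.mul_right (Dvd.dvd.mul_left (pow_dvd_pow Q ?_) _) _
  have : (n + 1 + 1).choose 2 = (n + 1) + (n + 1).choose 2 := by
    rw [Nat.choose_succ_succ' (n + 1) 1]; simp
  omega

/-- Write `1 = Q ^ (m + 1) + (1 - Q ^ (m + 1))` in the summand of index `m + 1`. The first piece
replaces `x` by `x * Q`; the second cancels the last factor of the denominator and lowers the index.
-/
lemma tsum_eulerTerm_eq {Q : Ser} (hQ : MvPowerSeries.constantCoeff Q = 0) (x : Ser) :
    ∑' m, eulerTerm Q x m = (1 + x) * ∑' m, eulerTerm Q (x * Q) m := by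
  have h0 := (summable_eulerTerm hQ x)
  have h1 := (summable_eulerTerm hQ (x * Q))
  have key : ∀ m, eulerTerm Q x (m + 1) =
      eulerTerm Q (x * Q) (m + 1) + x * eulerTerm Q (x * Q) m := by
    intro m
    have : (m + 1).choose 2 = m + m.choose 2 := by
      rw [Nat.choose_succ_succ' m 1]; simp
    simp only [eulerTerm, this, pochInv_eq_succ hQ m]
    ring
  rw [add_mul, one_mul, h0.tsum_eq_zero_add]
  simp_rw [key]
  rw [((summable_nat_add_iff 1).2 h1).tsum_add (h1.mul_left x), h1.tsum_mul_left]
  have h2 : eulerTerm Q x 0 = eulerTerm Q (x * Q) 0 := by simp [eulerTerm]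
  linear_combination h2 - h1.tsum_eq_zero_add

lemma tsum_eulerTerm_eq_prod {Q : Ser} (hQ : MvPowerSeries.constantCoeff Q = 0) (x : Ser)
    (n : ℕ) : ∑' m, eulerTerm Q x m =
      (∏ k ∈ Finset.range n, (1 + x * Q ^ k)) * ∑' m, eulerTerm Q (x * Q ^ n) m := by
  induction n with
  | zero => simp
  | succ n ih =>
    rw [ih, tsum_eulerTerm_eq hQ (x * Q ^ n), Finset.prod_range_succ, pow_succ]
    ring_nf

/-- All summands except the one of index 0 are divisible by `Q ^ n`. -/
lemma tendsto_tsum_eulerTerm {Q : Ser} (hQ : MvPowerSeries.constantCoeff Q = 0) (x : Ser) :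
    Filter.Tendsto (fun n => ∑' m, eulerTerm Q (x * Q ^ n) m) Filter.atTop (nhds 1) := by
  suffices h : Filter.Tendsto (fun n => ∑' m, eulerTerm Q (x * Q ^ n) (m + 1))
      Filter.atTop (nhds 0) by
    have := h.const_add 1
    rw [add_zero] at this
    refine this.congr fun n => ?_
    rw [(summable_eulerTerm hQ _).tsum_eq_zero_add]
    simp [eulerTerm, pochInv_zero]
  refine tendsto_zero_of_le_order fun n => MvPowerSeries.nat_le_order fun d hd => ?_
  have hs := (summable_nat_add_iff 1).2 (summable_eulerTerm hQ (x * Q ^ n))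
  have := (MvPowerSeries.WithPiTopology.hasSum_iff_hasSum_coeff.1 hs.hasSum) d
  refine this.tsum_eq.symm.trans ((tsum_congr fun m => ?_).trans tsum_zero)
  refine MvPowerSeries.coeff_of_lt_order (lt_of_lt_of_le (by exact_mod_cast hd)
    (le_order_of_pow_dvd hQ (n := n) ?_))
  refine Dvd.dvd.mul_right (Dvd.dvd.mul_right ?_ _) _
  rw [pow_succ]
  exact Dvd.dvd.mul_left (Dvd.intro_left _ rfl) _

/-- **Euler's identity**: `(-x; Q)_∞ = ∑ x ^ m Q ^ (m (m - 1) / 2) / (Q; Q)_m`. -/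
lemma hasSum_eulerTerm {Q : Ser} (hQ : MvPowerSeries.constantCoeff Q = 0) (x : Ser) :
    HasSum (eulerTerm Q x) (qPoch (-x) Q) := by
  convert (summable_eulerTerm hQ x).hasSum
  have h1 := (multipliable_qPoch (-x) Q hQ).hasProd.tendsto_prod_nat
  have h2 := h1.mul (tendsto_tsum_eulerTerm hQ x)
  rw [mul_one] at h2
  refine tendsto_nhds_unique h2 (tendsto_const_nhds.congr fun n => ?_)
  rw [tsum_eulerTerm_eq_prod hQ x n]
  simp [sub_eq_add_neg]

lemma negPoch_mul_qPoch (n : ℕ) : negPoch n * qPoch (-q ^ (n + 1)) q = qPoch (-q) q := by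
  have h1 := multipliable_qPoch (-q ^ (n + 1)) q constantCoeff_q
  have key : (fun m => 1 - -q ^ (n + 1) * q ^ m) = fun m => 1 - -q * q ^ (m + n) := by
    funext m
    ring
  rw [key] at h1
  have h2 := h1.prod_mul_tprod_nat_mul' (f := fun m => 1 - -q * q ^ m)
  rw [qPoch, qPoch, key, ← h2, negPoch]
  congr 1
  refine Finset.prod_congr rfl fun k _ => ?_
  ring

/-! ### Color words and the closed form of their generating function -/

instance : Fintype Color := ⟨{.a, .b, .u}, by rintro ⟨⟩ <;> decide⟩

lemma sum_color {M : Type*} [AddCommMonoid M] (f : Color → M) :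
    ∑ c, f c = f .a + f .b + f .u := by
  change ∑ c ∈ {Color.a, Color.b, Color.u}, f c = _
  simp [add_assoc]

/-- The entries `minDiff false y x`, made non-negative by lowering all parts colored `b` by one. -/
def cost : Color → Color → ℕ
  | .a, .a => 1
  | .a, .u => 1
  | .b, .b => 1
  | .b, .u => 1
  | _, _ => 0

/-- The triangular number `z (z + 1) / 2` of an integer. -/
def tri (z : ℤ) : ℕ := (z * (z + 1) / 2).toNat

lemma two_mul_tri (z : ℤ) : 2 * (tri z : ℤ) = z * (z + 1) := by
  have h1 : 0 ≤ z * (z + 1) := by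
    rcases le_or_gt 0 z with h | h
    · positivity
    · nlinarith
  rw [tri, Int.toNat_of_nonneg (by omega), Int.mul_ediv_cancel' (Int.even_mul_succ_self z).two_dvd]

lemma tri_neg (z : ℤ) : (tri (-z) : ℤ) = tri z - z := by
  linarith [two_mul_tri z, two_mul_tri (-z)]

lemma tri_sub_one (z : ℤ) : tri (z - 1) = tri (-z) := by
  have := two_mul_tri (z - 1)
  have := two_mul_tri (-z)
  zify
  linarith

/-- The reciprocal of `(q²; q²)_i (q²; q²)_j (q; q)_m`. -/
noncomputable def tripleInv (i j m : ℕ) : Ser :=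
  pochInv (q ^ 2) i * pochInv (q ^ 2) j * pochInv q m

/-- The generating function of the color words with `κ c` letters `c`, followed by the letter `x`,
divided by `(q; q)_s` where `s` is the length of the words. -/
noncomputable def wordSeries (x : Color) (κ : Color → ℕ) : Ser :=
  match x with
  | .a => q ^ tri (κ .a - κ .b) * negPoch (κ .a + κ .b) * tripleInv (κ .a) (κ .b) (κ .u)
  | .b => q ^ tri (κ .b - κ .a) * negPoch (κ .a + κ .b) * tripleInv (κ .a) (κ .b) (κ .u)
  | .u => if κ .a + κ .b = 0 then pochInv q (κ .u) else
      q ^ (tri (κ .a - κ .b) + κ .b) * negPoch (κ .a + κ .b - 1) * (q ^ κ .a + q ^ κ .b) *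
        tripleInv (κ .a) (κ .b) (κ .u)

/-- Remove one letter `y`. -/
def decr (κ : Color → ℕ) (y : Color) : Color → ℕ := Function.update κ y (κ y - 1)

/-- The number of letters. -/
def size (κ : Color → ℕ) : ℕ := κ .a + κ .b + κ .u

lemma size_decr {κ : Color → ℕ} {y : Color} (h : κ y ≠ 0) : size (decr κ y) = size κ - 1 := by
  cases y <;> simp [size, decr] <;> omega

/-- The factor `1 - Q ^ n` vanishes at `n = 0`, so an absent letter needs no separate formula. -/
lemma pochInv_pred {Q : Ser} (hQ : MvPowerSeries.constantCoeff Q = 0) (n : ℕ) :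
    (if n = 0 then 0 else pochInv Q (n - 1)) = (1 - Q ^ n) * pochInv Q n := by
  cases n with
  | zero => simp
  | succ n => simp [pochInv_eq_succ hQ n]

/-- This and the next two lemmas extract the common factor `negPoch r * tripleInv ..` from the three
terms of the recursion. What remains is polynomial in the powers of `q`. -/
lemma wordSeries_decr_a {κ : Color → ℕ} {r : ℕ} (hr : κ .a + κ .b = r + 1) :
    (if κ .a = 0 then 0 else wordSeries .a (decr κ .a)) =
      q ^ tri (κ .b - κ .a) * (1 - q ^ (2 * κ .a)) * (negPoch r *
        tripleInv (κ .a) (κ .b) (κ .u)) := by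
  rw [pow_mul]
  have h := pochInv_pred constantCoeff_q_sq (κ .a)
  split_ifs at h ⊢ with h0
  · rw [tripleInv]
    linear_combination (q ^ tri (κ .b - κ .a) * negPoch r * pochInv (q ^ 2) (κ .b) *
      pochInv q (κ .u)) * h
  · have e1 : ((κ .a - 1 : ℕ) : ℤ) - κ .b = (κ .a - κ .b : ℤ) - 1 := by omega
    have e2 : κ .a - 1 + κ .b = r := by omega
    simp only [wordSeries, decr, Function.update_self, ne_eq, reduceCtorEq, not_false_eq_true,
      Function.update_of_ne, e1, tri_sub_one, neg_sub, e2, tripleInv, h]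
    ring

lemma wordSeries_decr_b {κ : Color → ℕ} {r : ℕ} (hr : κ .a + κ .b = r + 1) :
    (if κ .b = 0 then 0 else wordSeries .b (decr κ .b)) =
      q ^ tri (κ .a - κ .b) * (1 - q ^ (2 * κ .b)) * (negPoch r *
        tripleInv (κ .a) (κ .b) (κ .u)) := by
  rw [pow_mul]
  have h := pochInv_pred constantCoeff_q_sq (κ .b)
  split_ifs at h ⊢ with h0
  · rw [tripleInv]
    linear_combination (q ^ tri (κ .a - κ .b) * negPoch r * pochInv (q ^ 2) (κ .a) *
      pochInv q (κ .u)) * h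
  · have e1 : ((κ .b - 1 : ℕ) : ℤ) - κ .a = (κ .b - κ .a : ℤ) - 1 := by omega
    have e2 : κ .a + (κ .b - 1) = r := by omega
    simp only [wordSeries, decr, Function.update_self, ne_eq, reduceCtorEq, not_false_eq_true,
      Function.update_of_ne, e1, tri_sub_one, neg_sub, e2, tripleInv, h]
    ring

lemma wordSeries_decr_u {κ : Color → ℕ} {r : ℕ} (hr : κ .a + κ .b = r + 1) :
    (if κ .u = 0 then 0 else wordSeries .u (decr κ .u)) =
      q ^ (tri (κ .a - κ .b) + κ .b) * (q ^ κ .a + q ^ κ .b) * (1 - q ^ κ .u) * (negPoch r *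
        tripleInv (κ .a) (κ .b) (κ .u)) := by
  have h := pochInv_pred constantCoeff_q (κ .u)
  split_ifs at h ⊢ with h0
  · rw [tripleInv]
    linear_combination (q ^ (tri (κ .a - κ .b) + κ .b) * (q ^ κ .a + q ^ κ .b) * negPoch r *
      pochInv (q ^ 2) (κ .a) * pochInv (q ^ 2) (κ .b)) * h
  · simp only [wordSeries, decr, Function.update_self, ne_eq, reduceCtorEq, not_false_eq_true,
      Function.update_of_ne, tripleInv, h, hr, Nat.add_sub_cancel, Nat.succ_ne_zero, if_false]
    ring

/-- The recursion for `wordSeries` obtained by splitting off the last letter. -/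
lemma wordSeries_rec (x : Color) (κ : Color → ℕ) :
    (1 - q ^ size κ) * wordSeries x κ =
      ∑ y, q ^ (size κ * cost y x) * if κ y = 0 then 0 else wordSeries y (decr κ y) := by
  rw [sum_color]
  -- Words in `u` alone are separate because `wordSeries .u` has its own formula there.
  rcases Nat.eq_zero_or_eq_succ_pred (κ .a + κ .b) with h | h
  · have ha : κ .a = 0 := by omega
    have hb : κ .b = 0 := by omega
    have hu := pochInv_pred constantCoeff_q (κ .u)
    have hm : (if κ .u = 0 then 0 else wordSeries .u (decr κ .u)) =
        (1 - q ^ κ .u) * pochInv q (κ .u) := by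
      rw [← hu]
      simp [wordSeries, decr, ha, hb]
    have ht : tri 0 = 0 := rfl
    rw [hm]
    cases x <;> simp [wordSeries, size, ha, hb, cost, tripleInv, pochInv_zero, negPoch, ht]
  · rw [wordSeries_decr_a h, wordSeries_decr_b h, wordSeries_decr_u h]
    generalize (κ .a + κ .b).pred = r at h
    -- This relates the two triangular powers; modulo it, the recursion is a polynomial identity in
    -- `q ^ κ .a`, `q ^ κ .b` and `q ^ κ .u`.
    have e : q ^ tri (κ .b - κ .a) * q ^ κ .a = q ^ tri (κ .a - κ .b) * q ^ κ .b := by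
      rw [← pow_add, ← pow_add]
      congr 1
      have := tri_neg (κ .a - κ .b)
      rw [neg_sub] at this
      omega
    have e2 : q ^ r * q = q ^ κ .a * q ^ κ .b := by rw [← pow_succ, ← pow_add, h]
    cases x
    · simp only [wordSeries, size, cost, h, negPoch_succ]
      simp only [← h, pow_add, pow_one, pow_mul', mul_one, mul_zero, pow_zero, e2]
      linear_combination (-q ^ κ .b * q ^ κ .u * (1 - (q ^ κ .a) ^ 2) * negPoch r *
        tripleInv (κ .a) (κ .b) (κ .u)) * e
    · simp only [wordSeries, size, cost, h, negPoch_succ]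
      simp only [← h, pow_add, pow_one, pow_mul', mul_one, mul_zero, pow_zero, e2]
      linear_combination ((q ^ κ .a * q ^ κ .u * (1 - (q ^ κ .b) ^ 2) +
        (1 - q ^ κ .u) * (q ^ κ .a + q ^ κ .b)) * negPoch r *
        tripleInv (κ .a) (κ .b) (κ .u)) * e
    · have e3 : κ .a + κ .b - 1 = r := by omega
      simp only [wordSeries, size, cost, e3, if_neg (show κ .a + κ .b ≠ 0 by omega)]
      simp only [pow_add, pow_mul', mul_one, mul_zero, pow_zero]
      linear_combination (-q ^ κ .b * q ^ κ .u * (1 - (q ^ κ .a) ^ 2) * negPoch r *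
        tripleInv (κ .a) (κ .b) (κ .u)) * e

/-! ### Codes and their generating function for fixed color counts -/

/-- A color, an overlining flag, and the excess of a difference over its minimal value. -/
abbrev Code : Type := (Color × Bool) × ℕ

/-- The difference of the lowered sizes encoded by `c`, if the next part has color `x`. -/
def step (x : Color) (c : Code) : ℕ := cost c.1.1 x + c.1.2.toNat + c.2

/-- The sum of the lowered sizes of the parts encoded by a list (last part first), if a virtual
part of color `x` and lowered size zero follows. -/
def weight : Color → List Code → ℕ
  | _, [] => 0
  | x, c :: l => (l.length + 1) * step x c + weight c.1.1 l

/-- The number of codes of color `y`. -/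
def count (l : List Code) (y : Color) : ℕ := l.countP fun c => c.1.1 = y

/-- All but the last `t` codes are overlined. -/
def OverlinedAfter (t : ℕ) (l : List Code) : Prop :=
  ∀ c ∈ l.take (l.length - t), c.1.2 = true

lemma overlinedAfter_cons (t : ℕ) (c : Code) (l : List Code) :
    OverlinedAfter t (c :: l) ↔ (t < l.length + 1 → c.1.2 = true) ∧ OverlinedAfter t l := by
  rcases lt_or_ge t (l.length + 1) with h | h
  · have : l.length + 1 - t = (l.length - t) + 1 := by omega
    simp [OverlinedAfter, this, h]
  · have h1 : l.length + 1 - t = 0 := by omega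
    have h2 : l.length - t = 0 := by omega
    simp [OverlinedAfter, h1, h2, show ¬ t ≤ l.length by omega]

lemma size_count (l : List Code) : size (count l) = l.length := by
  induction l with
  | nil => simp [size, count]
  | cons c l ih =>
    obtain ⟨⟨y, o⟩, g⟩ := c
    simp only [size, count, List.countP_cons, List.length_cons] at *
    cases y <;> simp <;> omega

lemma count_cons_eq_iff (c : Code) (l : List Code) (κ : Color → ℕ) :
    count (c :: l) = κ ↔ κ c.1.1 ≠ 0 ∧ count l = decr κ c.1.1 := by
  obtain ⟨⟨y, o⟩, g⟩ := c
  have hc : ∀ z, count (((y, o), g) :: l) z = count l z + if y = z then 1 else 0 := by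
    intro z
    simp [count, List.countP_cons]
  constructor
  · rintro rfl
    refine ⟨by simp [hc], funext fun z => ?_⟩
    by_cases h : z = y
    · subst h; simp [decr, hc]
    · simp [decr, hc, h, Ne.symm h]
  · rintro ⟨h0, h⟩
    funext z
    rw [hc, h]
    by_cases hz : z = y
    · subst hz; simp [decr] at *; omega
    · simp [decr, hz, Ne.symm hz]

open Classical in
/-- The contribution of a list of codes to the generating function with color counts `κ`. -/
noncomputable def term (t : ℕ) (x : Color) (κ : Color → ℕ) (l : List Code) : Ser :=
  if count l = κ ∧ OverlinedAfter t l then q ^ weight x l else 0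

lemma le_weight (x : Color) (l : List Code) : ∀ c ∈ l, c.2 ≤ weight x l := by
  induction l generalizing x with
  | nil => simp
  | cons d l ih =>
    intro c hc
    rw [weight]
    rcases List.mem_cons.1 hc with rfl | hc
    · rw [step]; nlinarith
    · exact (ih d.1.1 c hc).trans (Nat.le_add_left _ _)

lemma finite_weight (x : Color) (s n : ℕ) :
    {l : List Code | l.length = s ∧ weight x l ≤ n}.Finite := by
  let f : (Color × Bool) × Fin (n + 1) → Code := Prod.map id Fin.val
  refine ((List.finite_length_eq _ s).image (List.map f)).subset ?_
  rintro l ⟨hs, hn⟩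
  obtain ⟨m, rfl⟩ : l ∈ Set.range (List.map f) := by
    rw [Set.range_list_map]
    intro c hc
    exact ⟨(c.1, ⟨c.2, Nat.lt_succ_of_le ((le_weight x l c hc).trans hn)⟩), rfl⟩
  exact ⟨m, by simpa using hs, rfl⟩

lemma summable_of_finite_coeff {ι : Type*} {f : ι → Ser}
    (h : ∀ d, {i | MvPowerSeries.coeff d (f i) ≠ 0}.Finite) : Summable f := by
  rw [MvPowerSeries.WithPiTopology.summable_iff_summable_coeff]
  exact fun d => summable_of_hasFiniteSupport (h d)

lemma coeff_q_pow (d : Fin 3 →₀ ℕ) (n : ℕ) (h : MvPowerSeries.coeff d (q ^ n) ≠ 0) :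
    d 2 = n := by
  rw [q, MvPowerSeries.coeff_X_pow] at h
  by_contra h'
  refine h (if_neg ?_)
  rintro rfl
  simp at h'

lemma summable_term (t : ℕ) (x : Color) (κ : Color → ℕ) : Summable (term t x κ) := by
  refine summable_of_finite_coeff fun d => (finite_weight x (size κ) (d 2)).subset ?_
  intro l hl
  simp only [Set.mem_ofPred_eq, term] at hl
  split_ifs at hl with h
  · exact ⟨by rw [← h.1, size_count], (coeff_q_pow d _ hl).ge⟩
  · simp at hl

/-- The contribution of the overlining of the `p`-th part. -/
noncomputable def ovFactor (t p : ℕ) : Ser := (if t < p then 0 else 1) + q ^ p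

open Classical in
-- The head encodes the last part, and raising it raises every part; hence each unit of its step
-- costs `size κ`.
lemma term_cons (t : ℕ) (x : Color) (κ : Color → ℕ) (c : Code) (l : List Code) :
    term t x κ (c :: l) = q ^ (size κ * c.2) * ((if t < size κ ∧ c.1.2 = false then 0 else
      q ^ (size κ * (cost c.1.1 x + c.1.2.toNat))) *
        if κ c.1.1 = 0 then 0 else term t c.1.1 (decr κ c.1.1) l) := by
  by_cases h0 : κ c.1.1 = 0
  · have : ¬ count (c :: l) = κ := fun h => ((count_cons_eq_iff c l κ).1 h).1 h0
    simp [term, h0, this]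
  by_cases h1 : count l = decr κ c.1.1
  · have h2 : count (c :: l) = κ := (count_cons_eq_iff c l κ).2 ⟨h0, h1⟩
    have h3 : size κ = l.length + 1 := by rw [← h2, size_count, List.length_cons]
    simp only [term, h0, h1, h2, if_false, overlinedAfter_cons, true_and, weight, step, ← h3]
    by_cases h4 : t < size κ <;> by_cases h6 : OverlinedAfter t l <;> cases h5 : c.1.2 <;>
      simp [h4, h6] <;> ring
  · have : ¬ count (c :: l) = κ := fun h => h1 ((count_cons_eq_iff c l κ).1 h).2
    simp [term, h1, this]

lemma isUnit_one_sub_q_pow {s : ℕ} (hs : s ≠ 0) : IsUnit (1 - q ^ s) := by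
  rw [MvPowerSeries.isUnit_iff_constantCoeff]
  simp [constantCoeff_q, hs]

/-- Overlining adds one unit of step for every color, so its contribution factors out of the sum
over colors. -/
lemma sum_ovFactor (t s : ℕ) (f : Color → Ser) (e : Color → ℕ) :
    ∑ p : Color × Bool, (if t < s ∧ p.2 = false then 0 else q ^ (s * (e p.1 + p.2.toNat))) * f p.1 =
      ovFactor t s * ∑ y, q ^ (s * e y) * f y := by
  rw [Fintype.sum_prod_type, Finset.mul_sum]
  refine Finset.sum_congr rfl fun y _ => ?_
  rw [Fintype.sum_bool, ovFactor]
  by_cases h : t < s <;> simp [h] <;> ring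

/-- The generating function of the code lists with color counts `κ`. -/
lemma hasSum_term (t : ℕ) (x : Color) (κ : Color → ℕ) :
    HasSum (term t x κ)
      (wordSeries x κ * ∏ p ∈ Finset.range (size κ), ovFactor t (p + 1)) := by
  induction hs : size κ generalizing x κ with
  | zero =>
    have h0 : ∀ c, κ c = 0 := by
      simp only [size] at hs
      rintro ⟨⟩ <;> omega
    have h1 : wordSeries x κ = 1 := by
      cases x <;> simp [wordSeries, h0, tripleInv, pochInv_zero, negPoch, show tri 0 = 0 from rfl]
    have h2 : term t x κ [] = 1 := by
      simp [term, OverlinedAfter, weight, funext_iff, h0, count]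
    rw [h1, Finset.range_zero, Finset.prod_empty, mul_one, ← h2]
    refine hasSum_single _ fun l hl => if_neg fun h => hl ?_
    rw [← List.length_eq_zero_iff, ← size_count, h.1, hs]
  | succ s ih =>
    have hS := (summable_term t x κ).hasSum
    set S := ∑' l, term t x κ l
    have hpos : size κ ≠ 0 := by omega
    let cons : Code × List Code → List Code := fun p => p.1 :: p.2
    have hinj : Function.Injective cons := by
      rintro ⟨c, l⟩ ⟨c', l'⟩ h
      simpa [cons] using h
    -- As `size κ` is positive, the empty list contributes nothing, and the sum may run over pairs
    -- of head and tail.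
    rw [← hinj.hasSum_iff] at hS
    swap
    · intro l hl
      cases l with
      | nil =>
        refine if_neg fun h => hpos ?_
        rw [← h.1, size_count, List.length_nil]
      | cons c l => exact (hl ⟨(c, l), rfl⟩).elim
    let K : Color × Bool → Ser := fun p =>
      (if t < size κ ∧ p.2 = false then 0 else q ^ (size κ * (cost p.1 x + p.2.toNat))) *
        ((if κ p.1 = 0 then 0 else wordSeries p.1 (decr κ p.1)) *
          ∏ p ∈ Finset.range s, ovFactor t (p + 1))
    have h1 : HasSum (fun c : Code => q ^ (size κ * c.2) * K c.1) S := by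
      refine hS.prod_fiberwise fun c => ?_
      simp only [Function.comp_apply, cons, term_cons]
      refine (HasSum.mul_left _ ?_).mul_left _
      split_ifs with h
      · simp
      · exact ih _ _ (by rw [size_decr h]; omega)
    -- The excess of the head is unrestricted, which produces the inverse of `1 - q ^ size κ`.
    have hgeo : HasSum (fun g : ℕ => q ^ (size κ * g)) (∑' g : ℕ, (q ^ size κ) ^ g) := by
      simp_rw [pow_mul]
      exact (MvPowerSeries.WithPiTopology.summable_pow_of_constantCoeff_eq_zero
        (by simp [constantCoeff_q, hpos])).hasSum
    have h2 : HasSum (fun p => (∑' g : ℕ, (q ^ size κ) ^ g) * K p) S :=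
      h1.prod_fiberwise fun p => hgeo.mul_right (K p)
    have h2 := h2.unique (hasSum_fintype _)
    have h3 := MvPowerSeries.WithPiTopology.one_sub_mul_tsum_pow_of_constantCoeff_eq_zero
      (f := q ^ size κ) (by simp [constantCoeff_q, hpos])
    have hK : ∑ p, K p = _ := sum_ovFactor t (size κ)
      (fun y => (if κ y = 0 then 0 else wordSeries y (decr κ y)) *
        ∏ p ∈ Finset.range s, ovFactor t (p + 1)) fun y => cost y x
    convert (summable_term t x κ).hasSum using 1
    apply (isUnit_one_sub_q_pow hpos).mul_left_cancel
    change _ = _ * S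
    rw [h2, ← Finset.mul_sum, ← mul_assoc, ← mul_assoc, h3, one_mul, hK, wordSeries_rec,
      Finset.prod_range_succ, hs, Finset.sum_mul, Finset.mul_sum]
    refine Finset.sum_congr rfl fun y _ => ?_
    ring

/-! ### The correspondence between jagged overpartitions and codes -/

/-- The amount by which the size of a part of the given color is lowered. -/
def lower : Color → ℕ
  | .b => 1
  | _ => 0

lemma minDiff_eq (o : Bool) (y x : Color) :
    minDiff o y x = cost y x + o.toNat + lower y - lower x := by
  cases o <;> cases y <;> cases x <;> rfl

/-- The parts (last part first) encoded by a list, if a part of color `x` and lowered size `v`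
follows. -/
def decode : Color → ℕ → List Code → List Part
  | _, _, [] => []
  | x, v, c :: l => ⟨v + step x c + lower c.1.1, c.1.1, c.1.2⟩ :: decode c.1.1 (v + step x c) l

/-- The code of a list of parts, inverse to `decode`. -/
def encode : Color → ℕ → List Part → List Code
  | _, _, [] => []
  | x, v, p :: l => ((p.color, p.overlined),
      p.size - lower p.color - v - cost p.color x - p.overlined.toNat) ::
        encode p.color (p.size - lower p.color) l

/-- The difference conditions for a list of parts (last part first), if a part of color `x` and
lowered size `v` follows. -/
def Admissible : Color → ℕ → List Part → Prop
  | _, _, [] => True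
  | x, v, p :: l => v + cost p.color x + p.overlined.toNat + lower p.color ≤ p.size ∧
      Admissible p.color (p.size - lower p.color) l

lemma encode_decode (x : Color) (v : ℕ) (l : List Code) : encode x v (decode x v l) = l := by
  induction l generalizing x v with
  | nil => rfl
  | cons c l ih =>
    simp only [decode, encode, Nat.add_sub_cancel, ih]
    congr 1
    ext <;> simp [step]
    omega

/-- Admissibility ensures that the subtractions in `encode` are not truncated. -/
lemma decode_encode (x : Color) (v : ℕ) (l : List Part) (h : Admissible x v l) :
    decode x v (encode x v l) = l := by
  induction l generalizing x v with
  | nil => rfl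
  | cons p l ih =>
    obtain ⟨h1, h2⟩ := h
    have e : v + step x ((p.color, p.overlined),
      p.size - lower p.color - v - cost p.color x - p.overlined.toNat) =
        p.size - lower p.color := by
      simp only [step]; omega
    simp only [decode, encode, e, ih _ _ h2]
    congr 2
    omega

lemma admissible_decode (x : Color) (v : ℕ) (l : List Code) : Admissible x v (decode x v l) := by
  induction l generalizing x v with
  | nil => trivial
  | cons c l ih =>
    refine ⟨by simp only [step]; omega, ?_⟩
    simpa only [Nat.add_sub_cancel] using ih _ _

lemma Admissible.le_size {x : Color} {v : ℕ} {l : List Part} (h : Admissible x v l) :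
    ∀ p ∈ l, v + p.overlined.toNat + lower p.color ≤ p.size := by
  induction l generalizing x v with
  | nil => simp
  | cons p l ih =>
    intro r hr
    obtain ⟨h1, h2⟩ := h
    rcases List.mem_cons.1 hr with rfl | hr
    · omega
    · have := ih h2 r hr
      omega

/-- The rule on final occurrences is automatic: lowered sizes weakly decrease along the sequence,
and an overlined part strictly exceeds every later part in lowered size. -/
lemma Admissible.pairwise {x : Color} {v : ℕ} {l : List Part} (h : Admissible x v l) :
    l.Pairwise fun y z => z.overlined = true → ¬ (y.size = z.size ∧ y.color = z.color) := by
  induction l generalizing x v with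
  | nil => simp
  | cons p l ih =>
    obtain ⟨h1, h2⟩ := h
    refine List.pairwise_cons.2 ⟨fun z hz ho he => ?_, ih h2⟩
    have := h2.le_size z hz
    simp only [ho, Bool.toNat_true, he.2] at this h1
    omega

lemma admissible_iff_isChain (p : Part) (l : List Part) (hp : lower p.color ≤ p.size) :
    Admissible p.color (p.size - lower p.color) l ↔
      (p :: l).IsChain fun y x =>
        minDiff x.overlined x.color y.color ≤ (x.size : ℤ) - (y.size : ℤ) := by
  induction l generalizing p with
  | nil => simp [Admissible]
  | cons r l ih =>
    have e : p.size - lower p.color + cost r.color p.color + r.overlined.toNat + lower r.color ≤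
        r.size ↔ minDiff r.overlined r.color p.color ≤ (r.size : ℤ) - (p.size : ℤ) := by
      rw [minDiff_eq]; omega
    rw [List.isChain_cons_cons, Admissible, e]
    refine and_congr_right fun h => ih r ?_
    rw [← e] at h
    omega

/-- The virtual part of color `a` and size 0 forces a last part of color `a` or `b` to be at least
1, or at least 2 if overlined, and a last overlined `u` to be positive. These are the forbidden last
parts together with positivity of overlined parts. -/
lemma isJagged_reverse_iff (l : List Part) : IsJagged l.reverse ↔ Admissible .a 0 l := by
  constructor
  · intro h
    cases l with
    | nil => trivial
    | cons p l =>
      have h1 : 0 + cost p.color .a + p.overlined.toNat + lower p.color ≤ p.size := by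
        have h2 := h.last_notMem p (by simp)
        have h3 := h.pos_of_overlined p (by simp)
        obtain ⟨s, c, o⟩ := p
        cases c <;> cases o <;> simp [cost, lower] at h2 h3 ⊢ <;> omega
      refine ⟨h1, ?_⟩
      rw [admissible_iff_isChain p l (by omega), ← List.isChain_reverse]
      exact h.diff_le
  · intro h
    refine ⟨fun p hp ho => ?_, List.pairwise_reverse.2 h.pairwise, ?_, ?_⟩
    · have := h.le_size p (List.mem_reverse.1 hp)
      simp only [ho, Bool.toNat_true] at this
      omega
    · cases l with
      | nil => simp
      | cons p l =>
        have h1 := h.1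
        obtain ⟨s, c, o⟩ := p
        cases c <;> cases o <;> simp [cost, lower] at h1 ⊢ <;> omega
    · rw [List.isChain_reverse]
      cases l with
      | nil => simp
      | cons p l => exact (admissible_iff_isChain p l (by have := h.1; omega)).1 h.2

lemma length_decode (x : Color) (v : ℕ) (l : List Code) : (decode x v l).length = l.length := by
  induction l generalizing x v with
  | nil => rfl
  | cons c l ih => simp [decode, ih]

lemma numColor_decode (x : Color) (v : ℕ) (l : List Code) (y : Color) :
    numColor y (decode x v l) = count l y := by
  induction l generalizing x v with
  | nil => rfl
  | cons c l ih =>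
    simp only [numColor, count, decode, List.countP_cons] at *
    rw [ih]

lemma sum_decode (x : Color) (v : ℕ) (l : List Code) :
    ((decode x v l).map Part.size).sum = l.length * v + weight x l + count l .b := by
  induction l generalizing x v with
  | nil => simp [decode, weight, count]
  | cons c l ih =>
    have : count (c :: l) .b = count l .b + lower c.1.1 := by
      obtain ⟨⟨y, o⟩, g⟩ := c
      cases y <;> simp [count, lower]
    simp only [decode, List.map_cons, List.sum_cons, ih, this, weight, List.length_cons]
    ring

lemma overlined_decode (x : Color) (v t : ℕ) (l : List Code) :
    (∀ p ∈ (decode x v l).take t, p.overlined = true) ↔ ∀ c ∈ l.take t, c.1.2 = true := by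
  induction l generalizing x v t with
  | nil => simp [decode]
  | cons c l ih =>
    cases t with
    | zero => simp
    | succ t => simp [decode, ih]

lemma numColor_reverse (y : Color) (l : List Part) : numColor y l.reverse = numColor y l :=
  List.countP_reverse

/-! ### The sum over all jagged overpartitions and its fibers -/

/-- The jagged overpartitions whose final `ℓ` parts are overlined, where `ℓ` is the number of
parts of color `b` or `u`. -/
def IsJagged₂ (l : List Part) : Prop :=
  IsJagged l ∧ ∀ x ∈ l.drop (l.length - (numColor .b l + numColor .u l)), x.overlined = true

lemma isJagged₂_decode_reverse (l : List Code) :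
    IsJagged₂ (decode .a 0 l).reverse ↔ OverlinedAfter (count l .a) l := by
  rw [IsJagged₂, isJagged_reverse_iff, List.drop_reverse]
  simp only [admissible_decode, true_and, List.mem_reverse, List.length_reverse,
    numColor_reverse, numColor_decode, length_decode, overlined_decode, OverlinedAfter]
  have := size_count l
  simp only [size] at this
  rw [show l.length - (l.length - (count l .b + count l .u)) = l.length - count l .a by omega]

open Classical in
/-- The monomial of a jagged overpartition counted by `C₂`. -/
noncomputable def jaggedTerm (l : List Part) : Ser :=
  if IsJagged₂ l then a ^ numColor .a l * b ^ numColor .b l * q ^ (l.map Part.size).sum else 0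

lemma length_eq_numColor (l : List Part) :
    l.length = numColor .a l + numColor .b l + numColor .u l := by
  induction l with
  | nil => rfl
  | cons p l ih =>
    obtain ⟨s, c, o⟩ := p
    simp only [numColor, List.countP_cons, List.length_cons] at *
    cases c <;> simp <;> omega

/-- Non-overlined parts can only lie before the final `ℓ` ones. Hence `k ≤ i`, so each monomial
receives finitely many contributions although `k` is not recorded. -/
lemma numNonOverlined_le {l : List Part} (h : IsJagged₂ l) :
    numNonOverlined l ≤ numColor .a l := by
  have h1 := length_eq_numColor l
  set ℓ := numColor .b l + numColor .u l with hℓ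
  have h2 : (l.drop (l.length - ℓ)).countP (fun x => !x.overlined) = 0 := by
    rw [List.countP_eq_zero]
    intro x hx
    simp [h.2 x hx]
  rw [numNonOverlined, ← List.take_append_drop (l.length - ℓ) l, List.countP_append, h2]
  have h3 := List.countP_le_length (p := fun x : Part => !x.overlined)
    (l := l.take (l.length - ℓ))
  rw [List.length_take] at h3
  rw [List.take_append_drop]
  omega

lemma coeff_monomial_ne_zero {d : Fin 3 →₀ ℕ} {i j n : ℕ}
    (h : MvPowerSeries.coeff d (a ^ i * b ^ j * q ^ n) ≠ 0) : d 0 = i ∧ d 1 = j ∧ d 2 = n := by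
  rw [a, b, q, MvPowerSeries.X_pow_eq, MvPowerSeries.X_pow_eq, MvPowerSeries.X_pow_eq,
    MvPowerSeries.monomial_mul_monomial, MvPowerSeries.monomial_mul_monomial,
    MvPowerSeries.coeff_monomial] at h
  split_ifs at h with hd
  · subst hd
    simp
  · exact (h rfl).elim

lemma summable_jaggedTerm : Summable jaggedTerm := by
  refine summable_of_finite_coeff fun d => ((Set.finite_Iic (d 0)).biUnion fun k _ =>
    finite_jagged (d 2) k (d 0) (d 1)).subset fun l hl => ?_
  simp only [Set.mem_ofPred_eq, jaggedTerm] at hl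
  split_ifs at hl with h
  · obtain ⟨h0, h1, h2⟩ := coeff_monomial_ne_zero hl
    exact Set.mem_biUnion (x := numNonOverlined l) (h0 ▸ numNonOverlined_le h)
      ⟨h.1, h2.symm, rfl, h0.symm, h1.symm⟩
  · simp at hl

/-- The parts encoded by a list whose first entry encodes the last part. -/
def decodeRev (l : List Code) : List Part := (decode .a 0 l).reverse

lemma decodeRev_injective : Function.Injective decodeRev := fun l l' h => by
  rw [← encode_decode .a 0 l, ← encode_decode .a 0 l', List.reverse_injective h]

lemma IsJagged₂.mem_range_decodeRev {l : List Part} (h : IsJagged₂ l) : l ∈ Set.range decodeRev := by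
  have h1 := h.1
  rw [← List.reverse_reverse l, isJagged_reverse_iff] at h1
  exact ⟨encode .a 0 l.reverse, by rw [decodeRev, decode_encode _ _ _ h1, List.reverse_reverse]⟩

/-- The extra power `q ^ count l .b` undoes the lowering of the parts colored `b`. -/
lemma jaggedTerm_decodeRev (l : List Code) : jaggedTerm (decodeRev l) =
    a ^ count l .a * b ^ count l .b * q ^ count l .b * term (count l .a) .a (count l) l := by
  rw [decodeRev]
  have h' := isJagged₂_decode_reverse l
  by_cases h : OverlinedAfter (count l .a) l
  · rw [jaggedTerm, if_pos (h'.2 h), term, if_pos ⟨rfl, h⟩, numColor_reverse, numColor_reverse,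
      numColor_decode, numColor_decode, List.map_reverse, List.sum_reverse, sum_decode]
    ring
  · rw [jaggedTerm, if_neg (mt h'.1 h), term, if_neg fun h2 => h h2.2, mul_zero]

lemma hasSum_jaggedTerm_decodeRev : HasSum (jaggedTerm ∘ decodeRev) (∑' l, jaggedTerm l) := by
  rw [decodeRev_injective.hasSum_iff]
  · exact summable_jaggedTerm.hasSum
  · exact fun l hl => if_neg fun h => hl h.mem_range_decodeRev

lemma hasSum_C₂ : HasSum (fun p : ℕ × ℕ × ℕ × ℕ => (C₂ p.1 p.2.1 p.2.2.1 p.2.2.2 : Ser) *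
    (a ^ p.2.2.1 * b ^ p.2.2.2 * q ^ p.1)) (∑' l, jaggedTerm l) := by
  let key : List Part → ℕ × ℕ × ℕ × ℕ := fun l =>
    ((l.map Part.size).sum, numNonOverlined l, numColor .a l, numColor .b l)
  refine ((Equiv.sigmaFiberEquiv key).hasSum_iff.2 summable_jaggedTerm.hasSum).sigma ?_
  rintro ⟨n, k, i, j⟩
  change HasSum (jaggedTerm ∘ ((↑) : {l | key l = (n, k, i, j)} → List Part))
    ((C₂ n k i j : Ser) * (a ^ i * b ^ j * q ^ n))
  rw [hasSum_subtype_iff_indicator]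
  have hfin := finite_jagged₂ n k i j
  have hmem : ∀ l, l ∈ jagged₂ n k i j ↔ l ∈ {l | key l = (n, k, i, j)} ∧ IsJagged₂ l := by
    intro l
    simp only [jagged₂, jagged, IsJagged₂, key, Set.mem_ofPred_eq, Prod.mk.injEq]
    tauto
  have hzero : ∀ l ∉ hfin.toFinset, Set.indicator {l | key l = (n, k, i, j)} jaggedTerm l = 0 := by
    intro l hl
    rw [hfin.mem_toFinset, hmem] at hl
    by_cases h1 : l ∈ {l | key l = (n, k, i, j)}
    · rw [Set.indicator_of_mem h1]
      exact if_neg fun h2 => hl ⟨h1, h2⟩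
    · exact Set.indicator_of_notMem h1 _
  have hsum : ∑ l ∈ hfin.toFinset, Set.indicator {l | key l = (n, k, i, j)} jaggedTerm l =
      (C₂ n k i j : Ser) * (a ^ i * b ^ j * q ^ n) := by
    rw [C₂, Set.ncard_eq_toFinset_card _ hfin, ← nsmul_eq_mul, ← Finset.sum_const]
    refine Finset.sum_congr rfl fun l hl => ?_
    obtain ⟨h1, h2⟩ := (hmem l).1 (hfin.mem_toFinset.1 hl)
    rw [Set.indicator_of_mem h1, jaggedTerm, if_pos h2]
    simp only [key, Set.mem_ofPred_eq, Prod.mk.injEq] at h1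
    rw [h1.1, h1.2.2.1, h1.2.2.2]
  rw [← hsum]
  exact hasSum_sum_of_ne_finset_zero hzero

/-! ### Summation over the color counts -/

/-- The color counts `i`, `j`, `m`. -/
def counts (i j m : ℕ) : Color → ℕ
  | .a => i
  | .b => j
  | .u => m

/-- The contribution of the color counts `i`, `j`, `m`. -/
noncomputable def countsTerm (i j m : ℕ) : Ser :=
  a ^ i * b ^ j * q ^ j * (wordSeries .a (counts i j m) *
    ∏ r ∈ Finset.range (i + j + m), ovFactor i (r + 1))

lemma hasSum_countsTerm :
    HasSum (fun p : (ℕ × ℕ) × ℕ => countsTerm p.1.1 p.1.2 p.2) (∑' l, jaggedTerm l) := by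
  let key : List Code → (ℕ × ℕ) × ℕ := fun l => ((count l .a, count l .b), count l .u)
  refine ((Equiv.sigmaFiberEquiv key).hasSum_iff.2 hasSum_jaggedTerm_decodeRev).sigma ?_
  rintro ⟨⟨i, j⟩, m⟩
  change HasSum ((jaggedTerm ∘ decodeRev) ∘ ((↑) : {l | key l = ((i, j), m)} → List Code)) _
  rw [hasSum_subtype_iff_indicator]
  have heq : Set.indicator {l | key l = ((i, j), m)} (jaggedTerm ∘ decodeRev) =
      fun l => a ^ i * b ^ j * q ^ j * term i .a (counts i j m) l := by
    funext l
    have hkey : l ∈ {l | key l = ((i, j), m)} ↔ count l = counts i j m := by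
      simp only [key, Set.mem_ofPred_eq, Prod.mk.injEq, funext_iff]
      exact ⟨fun h => by rintro ⟨⟩ <;> simp [counts, h], fun h => ⟨⟨h .a, h .b⟩, h .u⟩⟩
    by_cases h : l ∈ {l | key l = ((i, j), m)}
    · rw [Set.indicator_of_mem h, Function.comp_apply, jaggedTerm_decodeRev, hkey.1 h]
      rfl
    · rw [Set.indicator_of_notMem h, term, if_neg fun h' => h (hkey.2 h'.1), mul_zero]
  rw [heq]
  exact (hasSum_term i .a (counts i j m)).mul_left (a ^ i * b ^ j * q ^ j)

lemma negPoch_mul_pochInv (n : ℕ) : negPoch n * pochInv (q ^ 2) n = pochInv q n := by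
  apply (isUnit_poch constantCoeff_q n).mul_left_cancel
  have : poch (q ^ 2) n = poch q n * negPoch n := by
    rw [poch, poch, negPoch, ← Finset.prod_mul_distrib]
    exact Finset.prod_congr rfl fun k _ => by ring
  rw [poch_mul_pochInv constantCoeff_q, ← mul_assoc, ← this, poch_mul_pochInv constantCoeff_q_sq]

lemma prod_ovFactor (i n : ℕ) : ∏ r ∈ Finset.range (i + n), ovFactor i (r + 1) =
    negPoch i * q ^ (i * n + (n + 1).choose 2) := by
  rw [Finset.prod_range_add, negPoch]
  congr 1
  · refine Finset.prod_congr rfl fun k hk => ?_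
    rw [ovFactor, if_neg (by have := Finset.mem_range.1 hk; omega)]
  · induction n with
    | zero => simp
    | succ n ih =>
      rw [Finset.prod_range_succ, ih, ovFactor, if_pos (by omega), zero_add, ← pow_add,
        Nat.choose_succ_succ' (n + 1) 1, Nat.choose_one_right]
      congr 1
      ring

lemma two_mul_choose_two (n : ℕ) : 2 * (n.choose 2 : ℤ) = n * (n - 1) := by
  induction n with
  | zero => simp
  | succ n ih =>
    rw [Nat.choose_succ_succ' n 1, Nat.choose_one_right]
    push_cast
    linarith

lemma countsTerm_eq (i j m : ℕ) : countsTerm i j m =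
    eulerTerm q (a * q) i * (eulerTerm (q ^ 2) (b * q ^ 2) j *
      (negPoch (i + j) * eulerTerm q (q ^ (i + j + 1)) m)) := by
  -- The cross term `-i * j` of the triangular number cancels against `i * j` from the forced
  -- overlinings, which decouples `i` from `j`.
  have e : tri (i - j) + j + (i * (j + m) + (j + m + 1).choose 2) =
      i + i.choose 2 + (2 * j + 2 * j.choose 2) + ((i + j + 1) * m + m.choose 2) := by
    have h1 := two_mul_tri (i - j)
    have h2 := two_mul_choose_two i
    have h3 := two_mul_choose_two j
    have h4 := two_mul_choose_two m
    have h5 := two_mul_choose_two (j + m + 1)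
    push_cast at h5
    zify
    linarith
  have e' : q ^ tri (i - j) * q ^ j * q ^ (i * (j + m) + (j + m + 1).choose 2) =
      q ^ i * q ^ i.choose 2 * ((q ^ 2) ^ j * (q ^ 2) ^ j.choose 2) *
        ((q ^ (i + j + 1)) ^ m * q ^ m.choose 2) := by
    simp only [← pow_mul, ← pow_add, e]
  rw [countsTerm, add_assoc, prod_ovFactor]
  simp only [wordSeries, counts, eulerTerm, tripleInv, ← negPoch_mul_pochInv i, mul_pow]
  linear_combination (a ^ i * b ^ j * negPoch (i + j) * negPoch i * pochInv (q ^ 2) i *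
    pochInv (q ^ 2) j * pochInv q m) * e'

lemma tsum_jaggedTerm : ∑' l, jaggedTerm l =
    qPoch (-q) q * qPoch (-(a * q)) q * qPoch (-(b * q ^ 2)) (q ^ 2) := by
  have hm (i j : ℕ) : HasSum (fun m => countsTerm i j m)
      (eulerTerm q (a * q) i * (eulerTerm (q ^ 2) (b * q ^ 2) j * qPoch (-q) q)) := by
    simp_rw [countsTerm_eq]
    -- The finite product `negPoch (i + j)` completes the value of the sum over `m` to `(-q)_∞`,
    -- removing the dependence on `i + j`.
    rw [← negPoch_mul_qPoch (i + j)]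
    exact (((hasSum_eulerTerm constantCoeff_q _).mul_left _).mul_left _).mul_left _
  have hj (i : ℕ) : HasSum (fun j => eulerTerm q (a * q) i *
      (eulerTerm (q ^ 2) (b * q ^ 2) j * qPoch (-q) q))
      (eulerTerm q (a * q) i * (qPoch (-(b * q ^ 2)) (q ^ 2) * qPoch (-q) q)) :=
    ((hasSum_eulerTerm constantCoeff_q_sq _).mul_right _).mul_left _
  have hi := (hasSum_eulerTerm constantCoeff_q (a * q)).mul_right
    (qPoch (-(b * q ^ 2)) (q ^ 2) * qPoch (-q) q)
  have h := hasSum_countsTerm.prod_fiberwise fun p => hm p.1 p.2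
  rw [(h.prod_fiberwise hj).unique hi]
  ring

end Capparelli

theorem mainTheorem5 :
    HasSum
      (fun p : ℕ × ℕ × ℕ × ℕ => match p with
        | (n, k, i, j) =>
          (Capparelli.C₂ n k i j : Capparelli.Ser) *
            (Capparelli.a ^ i * Capparelli.b ^ j * Capparelli.q ^ n))
      (Capparelli.qPoch (-Capparelli.q) Capparelli.q *
        Capparelli.qPoch (-(Capparelli.a * Capparelli.q)) Capparelli.q *
        Capparelli.qPoch (-(Capparelli.b * Capparelli.q ^ 2)) (Capparelli.q ^ 2)) := by
  rw [← Capparelli.tsum_jaggedTerm]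
  exact Capparelli.hasSum_C₂
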